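/- A *contact relation* on a Boolean algebra $B$ (with $0=1$ allowed) is a binary relation $\rho$ such that for all $a,b,c\in B$: (C1) $a\neq 0$ implies $a\rho a$; (C2) $a\rho b$ implies $a\ne 0$ and $b\neq 0$; (C3) $a\rho b$ implies $b\rho a$; (C4) $a\rho(b\vee c)$ iff $a\rho b$ or $a\rho c$. Write $a\ll_\rho b$ if $a\rho b^*$ fails, where $b^*$ is the complement of $b$. A *complete local contact algebra* is a triple $(B,\rho,\mathbb{B})$ in which $B$ is a complete Boolean algebra, $\rho$ is a contact relation on $B$, and $\mathbb{B}$ is a (possibly non-proper) ideal of $B$, whose elements are called bounded, such that: - (BC1) if $a\in\mathbb{B}$, $c\in B$ and $a\ll_\rho c$, then $a\ll_\rho b\ll_\rho c$ for some $b\in\mathbb{B}$; - (BC2) if $a\rho b$, then $a\rho(c\wedge b)$ for some $c\in\mathbb{B}$; - (BC3) if $a\neq 0$, then there is $b\in\mathbb{B}\setminus\{0\}$ with $b\ll_\rho a$. For a complete Boolean homomorphism $\varphi:A\to B$ between complete Boolean algebras let $\varphi_\Lambda:B\to A$, $\varphi_\Lambda(b)=\bigwedge\{a\in A : b\le\varphi(a)\}$,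 be its left adjoint. Let $\mathbf{DSkeLC}$ be the category whose objects are all complete local contact algebras and whose morphisms $\varphi:(A,\rho,\mathbb{B})\to(B,\eta,\mathbb{B}')$ are all complete Boolean homomorphisms $\varphi:A\to B$ such that - (L1) for all $a,b\in A$, $\varphi(a)\,\eta\,\varphi(b)$ implies $a\rho b$; - (L2) $b\in\mathbb{B}'$ implies $\varphi_\Lambda(b)\in\mathbb{B}$. Let $\mathbf{DOpLC}$ be the subcategory of $\mathbf{DSkeLC}$ with the same objects, whose morphisms are those $\mathbf{DSkeLC}$-morphisms $\varphi:(A,\rho,\mathbb{B})\to(B,\eta,\mathbb{B}')$ that also satisfy - (LO) for all $a\in A$ and $b\in\mathbb{B}'$, $\varphi_\Lambda(b)\,\rho\,a$ implies $b\,\eta\,\varphi(a)$. Let $\mathbf{OpLC}$ be the category of all locally compact Hausdorff spaces and all open maps between them, where open maps are continuous by convention and need not be onto. **Theorem.** The categories $\mathbf{OpLC}$ and $\mathbf{DOpLC}$ are dually equivalent. Moreover, $\mathbf{DOpLC}$ is a non-full subcategory of $\mathbf{DSkeLC}$. -/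

import Mathlib

open CategoryTheory

universe u

namespace OpenDuality

/-! ### Locally compact Hausdorff spaces and open maps -/

/-- A locally compact Hausdorff space, as an object of `OpLC`. -/
structure OpLC : Type (u + 1) where
  carrier : Type u
  [top : TopologicalSpace carrier]
  [t2 : T2Space carrier]
  [locallyCompact : LocallyCompactSpace carrier]

namespace OpLC

attribute [instance] OpLC.top OpLC.t2 OpLC.locallyCompact

/-- A morphism of `OpLC`: a continuous map (not necessarily onto) that sends open sets to
open sets. -/
@[ext]
structure Hom (X Y : OpLC.{u}) where
  toFun : X.carrier → Y.carrier
  continuous : Continuous toFun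
  isOpenMap : IsOpenMap toFun

/-- The category of locally compact Hausdorff spaces and open maps. -/
instance : Category OpLC.{u} where
  Hom X Y := Hom X Y
  id X := ⟨id, continuous_id, IsOpenMap.id⟩
  comp f g := ⟨g.toFun ∘ f.toFun, g.continuous.comp f.continuous, g.isOpenMap.comp f.isOpenMap⟩

end OpLC

/-! ### Contact algebras and local contact algebras -/

/-- `C` is a contact relation on the Boolean algebra `B`. -/
structure IsContact {B : Type u} [BooleanAlgebra B] (C : B → B → Prop) : Prop where
  refl : ∀ a, a ≠ ⊥ → C a a
  ne_bot : ∀ a b, C a b → a ≠ ⊥ ∧ b ≠ ⊥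
  symm : ∀ a b, C a b → C b a
  sup_iff : ∀ a b c, C a (b ⊔ c) ↔ C a b ∨ C a c

/-- Non-tangential inclusion `a ≪ b` with respect to `C`: `a` is not in contact with the
complement of `b`. -/
def NonTangential {B : Type u} [BooleanAlgebra B] (C : B → B → Prop) (a b : B) : Prop :=
  ¬ C a bᶜ

/-- `(B, ρ, I)` is a local contact algebra; `I` is the ideal (possibly all of `B`) of bounded
elements. -/
structure IsLocalContact {B : Type u} [BooleanAlgebra B] (ρ : B → B → Prop)
    (I : Order.Ideal B) : Prop extends IsContact ρ where
  interpolate : ∀ a ∈ I, ∀ c, NonTangential ρ a c →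
    ∃ b ∈ I, NonTangential ρ a b ∧ NonTangential ρ b c
  exists_bounded_contact : ∀ a b, ρ a b → ∃ c ∈ I, ρ a (c ⊓ b)
  exists_bounded_nonTangential : ∀ a, a ≠ ⊥ → ∃ b ∈ I, b ≠ ⊥ ∧ NonTangential ρ b a

/-- The value at `b` of the left adjoint of `φ`: the meet of all `a` with `b ≤ φ a`. -/
def leftAdj {A B : Type u} [CompleteBooleanAlgebra A] [CompleteBooleanAlgebra B]
    (φ : CompleteLatticeHom A B) (b : B) : A :=
  sInf {a | b ≤ φ a}

theorem leftAdj_gc {A B : Type u} [CompleteBooleanAlgebra A] [CompleteBooleanAlgebra B]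
    (φ : CompleteLatticeHom A B) : GaloisConnection (leftAdj φ) φ := by
  intro b a
  constructor
  · intro h
    have h1 : b ≤ φ (leftAdj φ b) := by
      unfold leftAdj
      rw [map_sInf]
      apply le_sInf
      rintro _ ⟨x, hx, rfl⟩
      exact hx
    exact h1.trans (OrderHomClass.mono φ h)
  · intro h
    exact sInf_le h

theorem leftAdj_id {A : Type u} [CompleteBooleanAlgebra A] (b : A) :
    leftAdj (CompleteLatticeHom.id A) b = b :=
  (leftAdj_gc (CompleteLatticeHom.id A)).l_unique GaloisConnection.id (fun _ => rfl)

theorem leftAdj_comp {A B C : Type u} [CompleteBooleanAlgebra A] [CompleteBooleanAlgebra B]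
    [CompleteBooleanAlgebra C] (ψ : CompleteLatticeHom B C) (φ : CompleteLatticeHom A B) (c : C) :
    leftAdj (ψ.comp φ) c = leftAdj φ (leftAdj ψ c) :=
  (leftAdj_gc (ψ.comp φ)).l_unique ((leftAdj_gc ψ).compose (leftAdj_gc φ)) (fun _ => rfl)

/-! ### The categories `DSkeLC` and `DOpLC` -/

/-- A complete local contact algebra, as an object of `DSkeLC`. -/
structure DSkeLC : Type (u + 1) where
  carrier : Type u
  [algebra : CompleteBooleanAlgebra carrier]
  contact : carrier → carrier → Prop
  bounded : Order.Ideal carrier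
  isLocalContact : IsLocalContact contact bounded

namespace DSkeLC

attribute [instance] DSkeLC.algebra

/-- A morphism of `DSkeLC`: a complete Boolean homomorphism (a map preserving arbitrary joins and
meets, hence also `⊥`, `⊤` and complements) which reflects contact and whose left adjoint
preserves boundedness. -/
@[ext]
structure Hom (A B : DSkeLC.{u}) where
  toHom : CompleteLatticeHom A.carrier B.carrier
  reflects_contact : ∀ a b, B.contact (toHom a) (toHom b) → A.contact a b
  leftAdj_bounded : ∀ b ∈ B.bounded, leftAdj toHom b ∈ A.bounded

/-- The category of complete local contact algebras. -/
instance : Category DSkeLC.{u} where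
  Hom A B := Hom A B
  id A := ⟨CompleteLatticeHom.id A.carrier, fun _ _ h => h, fun b hb => by
    rw [leftAdj_id]; exact hb⟩
  comp f g := ⟨g.toHom.comp f.toHom,
    fun a b h => f.reflects_contact a b (g.reflects_contact _ _ h), fun c hc => by
      rw [leftAdj_comp]
      exact f.leftAdj_bounded _ (g.leftAdj_bounded c hc)⟩

end DSkeLC

/-- Condition (LO) on a morphism `φ` of `DSkeLC`. -/
def LO : MorphismProperty DSkeLC.{u} := fun A B φ =>
  ∀ a : A.carrier, ∀ b ∈ B.bounded,
    A.contact (leftAdj (DSkeLC.Hom.toHom φ) b) a → B.contact b (DSkeLC.Hom.toHom φ a)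

instance : LO.{u}.IsMultiplicative where
  id_mem A := fun a b _ h => by
    have h' : A.contact (leftAdj (CompleteLatticeHom.id A.carrier) b) a := h
    rw [leftAdj_id] at h'
    exact h'
  comp_mem {A B C} f g hf hg := fun a c hc h => by
    have h' : A.contact
        (leftAdj ((DSkeLC.Hom.toHom g).comp (DSkeLC.Hom.toHom f)) c) a := h
    rw [leftAdj_comp] at h'
    exact hg _ c hc (hf a _ (DSkeLC.Hom.leftAdj_bounded g c hc) h')

/-- The category `DOpLC`: all objects of `DSkeLC`, and those of its morphisms that satisfy
(LO). -/
abbrev DOpLC : Type (u + 1) := WideSubcategory LO.{u}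

end OpenDuality

namespace OpenDuality

open Set Topology TopologicalSpace Filter

/-! ### The complete Boolean algebra of regular open sets -/

/-! A locally compact Hausdorff space is sent to its regular open sets, with contact "closures meet"
and bounded "compact closure". Preimage along an open map commutes with closure and interior, hence
with the complete Boolean operations. The resulting contravariant functor is shown to be fully
faithful and essentially surjective.

Fullness: given `φ`, the sets `V` with `x ∈ φ V` form a filter, and (L2) traps some of their
closures in a compact set, so all the closures share a point `f x` (`limitSet_nonempty`). By (L1)
and (LO), `f ⁻¹' V = φ V` (`preimage_pointMap`), and this forces `f` to be continuous and open.

Essential surjectivity: an algebra is recovered from its space of ends. A prime ideal argument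
produces enough ends (`exists_isEnd`), so contact is meeting of closures; ultrafilters give
compactness; completeness makes every regular open set basic (`exists_basic_eq`).

Non-fullness: on the regular open sets of the unit interval, the identity into the same algebra with
overlap as contact satisfies (L1) and (L2), but not (LO). -/

/-- The regular open subsets of a topological space. -/
def RegularOpens (X : Type u) [TopologicalSpace X] : Type u := Heyting.Regular (Opens X)

namespace RegularOpens

section Basic

variable {X : Type u} [TopologicalSpace X]

instance : BooleanAlgebra (RegularOpens X) :=
  inferInstanceAs (BooleanAlgebra (Heyting.Regular (Opens X)))

instance : SetLike (RegularOpens X) X where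
  coe U := ((Heyting.Regular.val U : Opens X) : Set X)
  coe_injective _ _ h := Heyting.Regular.coe_injective (SetLike.coe_injective h)

theorem coe_le {U V : RegularOpens X} : U ≤ V ↔ (U : Set X) ⊆ V := Iff.rfl

theorem mono {U V : RegularOpens X} (h : U ≤ V) : (U : Set X) ⊆ V := h

theorem isOpen (U : RegularOpens X) : IsOpen (U : Set X) := (Heyting.Regular.val U : Opens X).isOpen

@[simp] theorem coe_bot : ((⊥ : RegularOpens X) : Set X) = ∅ := rfl

@[simp] theorem coe_compl (U : RegularOpens X) :
    ((Uᶜ : RegularOpens X) : Set X) = (closure (U : Set X))ᶜ := by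
  rw [← interior_compl]
  exact Opens.coe_compl_eq_interior_compl

@[simp] theorem interior_closure (U : RegularOpens X) : interior (closure (U : Set X)) = U := by
  have h : ((Uᶜᶜ : RegularOpens X) : Set X) = U := by rw [compl_compl]
  rw [coe_compl, coe_compl, closure_compl, compl_compl] at h
  exact h

theorem closure_coe_compl (U : RegularOpens X) :
    closure ((Uᶜ : RegularOpens X) : Set X) = (U : Set X)ᶜ := by
  rw [coe_compl, closure_compl, interior_closure]

/-- The regular open set with the given underlying set. -/
def mk' (s : Set X) (h : interior (closure s) = s) : RegularOpens X :=
  ⟨⟨s, h ▸ isOpen_interior⟩, by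
    refine SetLike.coe_injective ?_
    rw [Opens.coe_compl_eq_interior_compl, Opens.coe_compl_eq_interior_compl, interior_compl,
      interior_compl, closure_compl, compl_compl]
    exact h⟩

@[simp] theorem coe_mk' (s : Set X) (h : interior (closure s) = s) : (mk' s h : Set X) = s := rfl

/-- The regular open set `interior (closure s)`. -/
def ofSet (s : Set X) : RegularOpens X :=
  mk' (interior (closure s)) interior_closure_idem

@[simp] theorem coe_ofSet (s : Set X) : (ofSet s : Set X) = interior (closure s) := rfl

theorem ofSet_le {s : Set X} {U : RegularOpens X} (h : s ⊆ U) : ofSet s ≤ U := by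
  rw [coe_le, coe_ofSet, ← interior_closure U]
  exact interior_mono (closure_mono h)

theorem subset_ofSet {s : Set X} (h : IsOpen s) : s ⊆ ofSet s :=
  interior_maximal subset_closure h

theorem isLUB_ofSet (S : Set (RegularOpens X)) : IsLUB S (ofSet (⋃ U ∈ S, (U : Set X))) := by
  refine ⟨fun U hU => coe_le.2 ?_, fun V hV => ofSet_le (iUnion₂_subset fun U hU => hV hU)⟩
  exact (subset_biUnion_of_mem (u := fun U : RegularOpens X => (U : Set X)) hU).trans
    (subset_ofSet (isOpen_biUnion fun U _ => U.isOpen))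

theorem isGLB_ofSet (S : Set (RegularOpens X)) :
    IsGLB S (ofSet (interior (⋂ U ∈ S, (U : Set X)))) := by
  refine ⟨fun U hU => ?_, fun V hV => ?_⟩
  · have h : (⋂ U ∈ S, (U : Set X)) ⊆ U := fun x hx => mem_iInter₂.1 hx U hU
    exact ofSet_le (interior_subset.trans h)
  · have h : (V : Set X) ⊆ ⋂ U ∈ S, (U : Set X) := fun x hx =>
      mem_iInter₂.2 fun U hU => mono (hV hU) hx
    exact coe_le.2 ((interior_maximal h V.isOpen).trans (subset_ofSet isOpen_interior))

instance : CompleteBooleanAlgebra (RegularOpens X) where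
  __ := (inferInstance : BooleanAlgebra (RegularOpens X))
  sSup S := ofSet (⋃ U ∈ S, (U : Set X))
  sInf S := ofSet (interior (⋂ U ∈ S, (U : Set X)))
  isLUB_sSup := isLUB_ofSet
  isGLB_sInf := isGLB_ofSet

theorem coe_sSup (S : Set (RegularOpens X)) :
    ((sSup S : RegularOpens X) : Set X) = interior (closure (⋃ U ∈ S, (U : Set X))) := rfl

theorem coe_sInf (S : Set (RegularOpens X)) :
    ((sInf S : RegularOpens X) : Set X) = interior (closure (interior (⋂ U ∈ S, (U : Set X)))) := rfl

/-- The join can exceed the union, but stays inside the closure of the union. -/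
theorem closure_sup (U V : RegularOpens X) :
    closure ((U ⊔ V : RegularOpens X) : Set X) = closure (U : Set X) ∪ closure V := by
  refine subset_antisymm ?_ (union_subset (closure_mono (mono le_sup_left))
    (closure_mono (mono le_sup_right)))
  have h : U ⊔ V ≤ ofSet ((U : Set X) ∪ V) :=
    sup_le (coe_le.2 (subset_union_left.trans (subset_ofSet (U.isOpen.union V.isOpen))))
      (coe_le.2 (subset_union_right.trans (subset_ofSet (U.isOpen.union V.isOpen))))
  refine closure_minimal ((mono h).trans ?_) (isClosed_closure.union isClosed_closure)
  rw [coe_ofSet, closure_union]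
  exact interior_subset

theorem ne_bot_iff {U : RegularOpens X} : U ≠ ⊥ ↔ (U : Set X).Nonempty := by
  rw [nonempty_iff_ne_empty, ← coe_bot, Ne, Ne, SetLike.coe_set_eq]

/-- Two regular open sets are in contact when their closures meet. -/
def contact (U V : RegularOpens X) : Prop := (closure (U : Set X) ∩ closure V).Nonempty

theorem isContact : IsContact (contact (X := X)) where
  refl U h := by
    rw [contact, inter_self]
    exact (ne_bot_iff.1 h).closure
  ne_bot U V h := by
    simp only [ne_bot_iff]
    exact ⟨closure_nonempty_iff.1 h.left, closure_nonempty_iff.1 h.right⟩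
  symm U V h := by rwa [contact, inter_comm]
  sup_iff U V W := by rw [contact, closure_sup, inter_union_distrib_left, union_nonempty]; rfl

theorem nonTangential_iff {U V : RegularOpens X} :
    NonTangential contact U V ↔ closure (U : Set X) ⊆ V := by
  rw [NonTangential, contact, closure_coe_compl, inter_compl_nonempty_iff, not_not]

variable (X) in
/-- The ideal of regular open sets with compact closure. -/
def bounded : Order.Ideal (RegularOpens X) where
  carrier := {U | IsCompact (closure (U : Set X))}
  lower' _ _ h hU := hU.of_isClosed_subset isClosed_closure (closure_mono (mono h))
  nonempty' := ⟨⊥, by simp⟩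
  directed' U hU V hV := ⟨U ⊔ V, by
    change IsCompact _
    rw [closure_sup]
    exact IsCompact.union hU hV, le_sup_left, le_sup_right⟩

end Basic

/-! ### Regular open sets of a locally compact Hausdorff space -/

section LocallyCompact

variable {X : Type u} [TopologicalSpace X] [T2Space X] [LocallyCompactSpace X]

/-- The interior of a compact set between `K` and `s` need not be regular, but its regularization
stays inside that closed set. -/
theorem exists_between {K s : Set X} (hK : IsCompact K) (hs : IsOpen s) (h : K ⊆ s) :
    ∃ W ∈ bounded X, K ⊆ W ∧ closure (W : Set X) ⊆ s := by
  obtain ⟨L, hL, hKL, hLs⟩ := exists_compact_between hK hs h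
  have h1 : closure (interior L) ⊆ L := closure_minimal interior_subset hL.isClosed
  have h2 : closure (ofSet (interior L) : Set X) ⊆ L :=
    closure_minimal (interior_subset.trans h1) hL.isClosed
  exact ⟨ofSet (interior L), hL.of_isClosed_subset isClosed_closure h2,
    hKL.trans (subset_ofSet isOpen_interior), h2.trans hLs⟩

theorem exists_mem {x : X} {s : Set X} (hs : IsOpen s) (h : x ∈ s) :
    ∃ W ∈ bounded X, x ∈ W ∧ closure (W : Set X) ⊆ s := by
  simpa using exists_between isCompact_singleton hs (singleton_subset_iff.2 h)

theorem isLocalContact : IsLocalContact contact (bounded X) where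
  toIsContact := isContact
  interpolate U hU V h := by
    obtain ⟨W, hW, h1, h2⟩ := exists_between hU V.isOpen (nonTangential_iff.1 h)
    exact ⟨W, hW, nonTangential_iff.2 h1, nonTangential_iff.2 h2⟩
  exists_bounded_contact U V h := by
    obtain ⟨x, hxU, hxV⟩ := h
    obtain ⟨W, hW, hx, -⟩ := exists_mem isOpen_univ (mem_univ x)
    exact ⟨W, hW, x, hxU, W.isOpen.inter_closure ⟨hx, hxV⟩⟩
  exists_bounded_nonTangential U h := by
    obtain ⟨x, hx⟩ := ne_bot_iff.1 h
    obtain ⟨W, hW, hxW, h⟩ := exists_mem U.isOpen hx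
    exact ⟨W, hW, ne_bot_iff.2 ⟨x, hxW⟩, nonTangential_iff.2 h⟩

end LocallyCompact

/-! ### Preimages along open maps and their left adjoints -/

section Preimage

variable {X Y : Type u} [TopologicalSpace X] [TopologicalSpace Y]

/-- The preimage map of regular open sets along an open continuous map. -/
def preimage (f : X → Y) (hf : Continuous f) (ho : IsOpenMap f) :
    CompleteLatticeHom (RegularOpens Y) (RegularOpens X) where
  toFun V := mk' (f ⁻¹' V) (by
    rw [← ho.preimage_closure_eq_closure_preimage hf, ← ho.preimage_interior_eq_interior_preimage hf,
      interior_closure])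
  map_sInf' S := by
    refine SetLike.coe_injective ?_
    simp only [coe_mk', coe_sInf, ho.preimage_interior_eq_interior_preimage hf,
      ho.preimage_closure_eq_closure_preimage hf, preimage_iInter, biInter_image]
  map_sSup' S := by
    refine SetLike.coe_injective ?_
    simp only [coe_mk', coe_sSup, ho.preimage_interior_eq_interior_preimage hf,
      ho.preimage_closure_eq_closure_preimage hf, preimage_iUnion, biUnion_image]

@[simp] theorem coe_preimage (f : X → Y) (hf : Continuous f) (ho : IsOpenMap f)
    (V : RegularOpens Y) : (preimage f hf ho V : Set X) = f ⁻¹' V := rfl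

/-- The regular open set `ofSet (f '' U)` bounds the left adjoint, and its closure cannot leave the
image of `closure U`, which is compact and so closed. Both (L2) and (LO) rest on this. -/
theorem closure_leftAdj_preimage_subset [T2Space Y] {f : X → Y} (hf : Continuous f) (ho : IsOpenMap f)
    {U : RegularOpens X} (hU : U ∈ bounded X) :
    closure ((leftAdj (preimage f hf ho) U : RegularOpens Y) : Set Y) ⊆ f '' closure (U : Set X) := by
  have hc : IsClosed (f '' closure (U : Set X)) := (IsCompact.image hU hf).isClosed
  have h : leftAdj (preimage f hf ho) U ≤ ofSet (f '' U) :=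
    (leftAdj_gc _ U _).2 (coe_le.2 (by
      rw [coe_preimage]
      exact image_subset_iff.1 (subset_ofSet (ho _ U.isOpen))))
  refine closure_minimal ((mono h).trans (interior_subset.trans ?_)) hc
  exact closure_minimal (image_mono subset_closure) hc

end Preimage

end RegularOpens

/-- The complete local contact algebra of regular open sets of a locally compact Hausdorff space. -/
def regularOpensObj (X : OpLC.{u}) : DSkeLC.{u} where
  carrier := RegularOpens X.carrier
  contact := RegularOpens.contact
  bounded := RegularOpens.bounded X.carrier
  isLocalContact := RegularOpens.isLocalContact

/-- Taking preimages along an open map is a morphism of local contact algebras. -/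
def regularOpensMap {X Y : OpLC.{u}} (f : X ⟶ Y) : regularOpensObj Y ⟶ regularOpensObj X where
  toHom := RegularOpens.preimage f.toFun f.continuous f.isOpenMap
  reflects_contact U V h := by
    obtain ⟨x, hU, hV⟩ := h
    exact ⟨f.toFun x, f.continuous.closure_preimage_subset _ hU,
      f.continuous.closure_preimage_subset _ hV⟩
  leftAdj_bounded U hU := (IsCompact.image hU f.continuous).of_isClosed_subset isClosed_closure
    (RegularOpens.closure_leftAdj_preimage_subset f.continuous f.isOpenMap hU)

theorem regularOpensMap_LO {X Y : OpLC.{u}} (f : X ⟶ Y) : LO (regularOpensMap f) := by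
  rintro V U hU ⟨y, hyU, hyV⟩
  obtain ⟨x, hx, rfl⟩ :=
    RegularOpens.closure_leftAdj_preimage_subset f.continuous f.isOpenMap hU hyU
  exact ⟨x, hx, f.isOpenMap.preimage_closure_subset_closure_preimage hyV⟩

/-- The contravariant functor sending a locally compact Hausdorff space to its algebra of regular
open sets, and an open map to the preimage map. -/
def regularOpensFunctor : OpLC.{u}ᵒᵖ ⥤ DOpLC.{u} where
  obj X := ⟨regularOpensObj X.unop⟩
  map f := ⟨regularOpensMap f.unop, regularOpensMap_LO f.unop⟩

/-! ### The functor of regular open sets is fully faithful -/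

namespace RegularOpens

variable {X Y : Type u} [TopologicalSpace X] [TopologicalSpace Y]

/-- The points of `Y` that lie in the closure of every `V` with `x ∈ φ V`. -/
def limitSet (φ : CompleteLatticeHom (RegularOpens Y) (RegularOpens X)) (x : X) : Set Y :=
  {y | ∀ V, x ∈ φ V → y ∈ closure (V : Set Y)}

variable {φ : CompleteLatticeHom (RegularOpens Y) (RegularOpens X)}

theorem mem_map_leftAdj {U : RegularOpens X} {x : X} (hx : x ∈ U) : x ∈ φ (leftAdj φ U) :=
  (leftAdj_gc φ).le_u_l U hx

/-- Reflecting contact amounts to preserving `≪`, which here is inclusion of the closure. -/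
theorem closure_map_subset (hc : ∀ U V, contact (φ U) (φ V) → contact U V)
    {U V : RegularOpens Y} (h : closure (U : Set Y) ⊆ V) : closure (φ U : Set X) ⊆ φ V := by
  rw [← nonTangential_iff] at h ⊢
  rw [NonTangential, ← map_compl']
  exact fun h' => h (hc _ _ h')

section LocallyCompactCodomain

variable [T2Space Y] [LocallyCompactSpace Y]

theorem isTopologicalBasis : IsTopologicalBasis (range ((↑) : RegularOpens Y → Set Y)) := by
  refine isTopologicalBasis_of_isOpen_of_nhds ?_ fun y s hy hs => ?_
  · rintro _ ⟨V, rfl⟩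
    exact V.isOpen
  · obtain ⟨W, -, hW, hWs⟩ := exists_mem hs hy
    exact ⟨W, mem_range_self W, hW, subset_closure.trans hWs⟩

theorem eq_of_preimage_eq {Z : Type u} {f g : Z → Y}
    (h : ∀ V : RegularOpens Y, f ⁻¹' V = g ⁻¹' V) : f = g := by
  funext x
  by_contra hne
  obtain ⟨W, -, hW, hWs⟩ := exists_mem (isOpen_compl_singleton (x := g x)) hne
  have hx : x ∈ f ⁻¹' W := hW
  rw [h] at hx
  exact hWs (subset_closure hx) rfl

theorem continuous_of_preimage {f : X → Y} (h : ∀ V : RegularOpens Y, f ⁻¹' V = φ V) :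
    Continuous f := by
  refine isTopologicalBasis.continuous_iff.2 ?_
  rintro _ ⟨V, rfl⟩
  rw [h]
  exact (φ V).isOpen

/-- A point off the closed image has a neighbourhood `N` whose closure misses that image. Then `W ≤
φ Nᶜ`, so the left adjoint lies below `Nᶜ`. -/
theorem leftAdj_subset_image {f : X → Y} (h : ∀ V : RegularOpens Y, f ⁻¹' V = φ V)
    {W : RegularOpens X} (hW : W ∈ bounded X) :
    ((leftAdj φ W : RegularOpens Y) : Set Y) ⊆ f '' closure (W : Set X) := by
  intro y hy
  by_contra hyK
  have hK : IsClosed (f '' closure (W : Set X)) :=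
    (IsCompact.image hW (continuous_of_preimage h)).isClosed
  obtain ⟨N, -, hyN, hN⟩ := exists_mem hK.isOpen_compl hyK
  have h1 : W ≤ φ Nᶜ := by
    rw [coe_le, ← h, coe_compl]
    exact fun x hx hx' => hN hx' (mem_image_of_mem f (subset_closure hx))
  have h2 := mono ((leftAdj_gc φ _ _).2 h1) hy
  rw [coe_compl] at h2
  exact h2 (subset_closure hyN)

end LocallyCompactCodomain

variable [T2Space X] [LocallyCompactSpace X]

theorem limitSet_nonempty (hb : ∀ U ∈ bounded X, leftAdj φ U ∈ bounded Y) (x : X) :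
    (limitSet φ x).Nonempty := by
  obtain ⟨W, hW, hxW, -⟩ := exists_mem isOpen_univ (mem_univ x)
  -- Restricting to `V` below `leftAdj φ W` puts all the closures in one compact set; an arbitrary
  -- `V` is then handled through `V ⊓ leftAdj φ W`.
  let ι := {V : RegularOpens Y // x ∈ φ V ∧ V ≤ leftAdj φ W}
  have inf_mem : ∀ {V V' : RegularOpens Y}, x ∈ φ V → x ∈ φ V' → x ∈ φ (V ⊓ V') := by
    intro V V' h h'
    rw [InfHomClass.map_inf]
    exact ⟨h, h'⟩
  have ne_bot : ∀ {V : RegularOpens Y}, x ∈ φ V → (V : Set Y).Nonempty := by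
    intro V h
    rw [← ne_bot_iff]
    rintro rfl
    rw [BotHomClass.map_bot] at h
    exact h
  have : Nonempty ι := ⟨⟨leftAdj φ W, mem_map_leftAdj hxW, le_rfl⟩⟩
  obtain ⟨y, hy⟩ := IsCompact.nonempty_iInter_of_directed_nonempty_isCompact_isClosed
    (fun V : ι => closure ((V : RegularOpens Y) : Set Y))
    (fun V V' => ⟨⟨V ⊓ V', inf_mem V.2.1 V'.2.1, inf_le_left.trans V.2.2⟩,
      closure_mono (mono inf_le_left), closure_mono (mono inf_le_right)⟩)
    (fun V => (ne_bot V.2.1).closure)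
    (fun V => (bounded Y).lower V.2.2 (hb W hW)) (fun V => isClosed_closure)
  refine ⟨y, fun V hV => ?_⟩
  exact closure_mono (mono inf_le_left)
    (mem_iInter.1 hy ⟨V ⊓ leftAdj φ W, inf_mem hV (mem_map_leftAdj hxW), inf_le_right⟩)

/-- The map of spaces recovered from a homomorphism of algebras of regular open sets. -/
noncomputable def pointMap (hb : ∀ U ∈ bounded X, leftAdj φ U ∈ bounded Y) (x : X) : Y :=
  (limitSet_nonempty hb x).some

theorem pointMap_mem_closure (hb : ∀ U ∈ bounded X, leftAdj φ U ∈ bounded Y) {x : X}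
    {V : RegularOpens Y} (h : x ∈ φ V) : pointMap hb x ∈ closure (V : Set Y) :=
  (limitSet_nonempty hb x).some_mem V h

theorem mem_closure_map_of_pointMap_mem (hb : ∀ U ∈ bounded X, leftAdj φ U ∈ bounded Y) {x : X}
    {V : RegularOpens Y} (h : pointMap hb x ∈ V) : x ∈ closure (φ V : Set X) := by
  by_contra hx
  have h1 : x ∈ φ Vᶜ := by
    rw [map_compl', ← SetLike.mem_coe, coe_compl]
    exact hx
  have h2 := pointMap_mem_closure hb h1
  rw [closure_coe_compl] at h2
  exact h2 h

variable [T2Space Y] [LocallyCompactSpace Y]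

theorem preimage_pointMap (hc : ∀ U V, contact (φ U) (φ V) → contact U V)
    (hb : ∀ U ∈ bounded X, leftAdj φ U ∈ bounded Y)
    (ho : ∀ V, ∀ U ∈ bounded X, contact (leftAdj φ U) V → contact U (φ V)) (V : RegularOpens Y) :
    pointMap hb ⁻¹' V = φ V := by
  ext x
  constructor
  · intro hx
    obtain ⟨W, -, hxW, hWV⟩ := exists_mem V.isOpen hx
    exact closure_map_subset hc hWV (mem_closure_map_of_pointMap_mem hb hxW)
  · intro hx
    obtain ⟨W, hW, hxW, hWV⟩ := exists_mem (φ V).isOpen hx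
    -- (LO), contraposed, turns `W ≪ φ V` into `leftAdj φ W ≪ V`.
    have h : NonTangential contact (leftAdj φ W) V := by
      intro h
      have h' := ho _ _ hW h
      rw [map_compl'] at h'
      exact nonTangential_iff.2 hWV h'
    exact nonTangential_iff.1 h (pointMap_mem_closure hb (mem_map_leftAdj hxW))

/-- The left adjoint of a small neighbourhood of `x` is an open neighbourhood of `f x` inside the
image. -/
theorem isOpenMap_of_preimage {f : X → Y} (h : ∀ V : RegularOpens Y, f ⁻¹' V = φ V) :
    IsOpenMap f := by
  intro U hU
  rw [isOpen_iff_mem_nhds]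
  rintro _ ⟨x, hx, rfl⟩
  obtain ⟨W, hW, hxW, hWU⟩ := exists_mem hU hx
  refine mem_of_superset ((leftAdj φ W).isOpen.mem_nhds ?_)
    ((leftAdj_subset_image h hW).trans (image_mono hWU))
  change x ∈ f ⁻¹' ((leftAdj φ W : RegularOpens Y) : Set Y)
  rw [h]
  exact mem_map_leftAdj hxW

end RegularOpens

instance : regularOpensFunctor.{u}.Faithful where
  map_injective {X Y} f g h := by
    refine Quiver.Hom.unop_inj (OpLC.Hom.ext (RegularOpens.eq_of_preimage_eq fun V => ?_))
    have h' : regularOpensMap f.unop = regularOpensMap g.unop :=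
      congrArg (fun k => k.hom) h
    exact congrArg (fun k : regularOpensObj X.unop ⟶ regularOpensObj Y.unop =>
      SetLike.coe (A := RegularOpens Y.unop.carrier) (k.toHom V)) h'

instance : regularOpensFunctor.{u}.Full where
  map_surjective {X Y} φ := by
    have h := RegularOpens.preimage_pointMap (X := Y.unop.carrier) (Y := X.unop.carrier)
      (φ := φ.hom.toHom) φ.hom.reflects_contact φ.hom.leftAdj_bounded φ.property
    refine ⟨Quiver.Hom.op (X := Y.unop) (Y := X.unop) ⟨_, RegularOpens.continuous_of_preimage h,
      RegularOpens.isOpenMap_of_preimage h⟩, ?_⟩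
    refine WideSubcategory.hom_ext _ (DSkeLC.Hom.ext (CompleteLatticeHom.ext fun V => ?_))
    exact SetLike.coe_injective (A := RegularOpens Y.unop.carrier) (h V)

/-! ### Contact relations and non-tangential inclusion -/

namespace IsContact

variable {B : Type u} [BooleanAlgebra B] {ρ : B → B → Prop}

theorem mono_right (h : IsContact ρ) {a b c : B} (hbc : b ≤ c) (hab : ρ a b) : ρ a c := by
  rw [← sup_eq_right.2 hbc]
  exact (h.sup_iff _ _ _).2 (Or.inl hab)

theorem mono (h : IsContact ρ) {a b c d : B} (hab : a ≤ b) (hcd : c ≤ d) (hac : ρ a c) : ρ b d :=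
  h.mono_right hcd (h.symm _ _ (h.mono_right hab (h.symm _ _ hac)))

theorem of_inf_ne_bot (h : IsContact ρ) {a b : B} (hab : a ⊓ b ≠ ⊥) : ρ a b :=
  h.mono inf_le_left inf_le_right (h.refl _ hab)

theorem nt_le (h : IsContact ρ) {a b : B} (hab : NonTangential ρ a b) : a ≤ b := by
  by_contra hne
  refine hab (h.of_inf_ne_bot fun h0 => hne ?_)
  rwa [← disjoint_compl_right_iff, disjoint_iff]

theorem nt_mono (h : IsContact ρ) {a b c d : B} (hab : a ≤ b) (hcd : c ≤ d)
    (hbc : NonTangential ρ b c) :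
    NonTangential ρ a d :=
  fun had => hbc (h.mono hab (compl_le_compl hcd) had)

theorem nt_inf (h : IsContact ρ) {a b c d : B} (hac : NonTangential ρ a c) (hbd : NonTangential ρ b d) :
    NonTangential ρ (a ⊓ b) (c ⊓ d) := by
  rw [NonTangential, compl_inf, h.sup_iff]
  rintro (h' | h')
  · exact hac (h.mono inf_le_left le_rfl h')
  · exact hbd (h.mono inf_le_right le_rfl h')

theorem nt_compl (h : IsContact ρ) {a b : B} (hab : NonTangential ρ a b) : NonTangential ρ bᶜ aᶜ := by
  rw [NonTangential, compl_compl]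
  exact fun h' => hab (h.symm _ _ h')

theorem nt_top (h : IsContact ρ) (a : B) : NonTangential ρ a ⊤ := by
  rw [NonTangential, compl_top]
  exact fun h' => (h.ne_bot _ _ h').2 rfl

end IsContact

/-! ### The space of ends of a local contact algebra -/

/-- An end of a local contact algebra: a proper filter which is generated by bounded
non-tangentially smaller members, and is maximal with respect to bounded non-tangential
inclusions. -/
structure IsEnd {B : Type u} [BooleanAlgebra B] (ρ : B → B → Prop) (I : Order.Ideal B)
    (p : Set B) : Prop where
  top_mem : ⊤ ∈ p
  bot_notMem : ⊥ ∉ p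
  inf_mem : ∀ {a b}, a ∈ p → b ∈ p → a ⊓ b ∈ p
  mem_of_le : ∀ {a b}, a ≤ b → a ∈ p → b ∈ p
  round : ∀ {a}, a ∈ p → ∃ b ∈ I, b ∈ p ∧ NonTangential ρ b a
  maximal : ∀ {a b}, a ∈ I → NonTangential ρ a b → aᶜ ∈ p ∨ b ∈ p

/-- A proper filter `P` with a bounded member that decides non-tangential inclusions into bounded
elements yields an end, the set of elements non-tangentially above bounded members of `P`. -/
theorem IsLocalContact.isEnd_of {B : Type u} [BooleanAlgebra B] {ρ : B → B → Prop}
    {I : Order.Ideal B} (h : IsLocalContact ρ I) {P : B → Prop} (hbot : ¬ P ⊥)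
    (hinf : ∀ {a b}, P a → P b → P (a ⊓ b)) (hbdd : ∃ e ∈ I, P e)
    (hmax : ∀ {a b}, b ∈ I → NonTangential ρ a b → P aᶜ ∨ P b) :
    IsEnd ρ I {c | ∃ d ∈ I, P d ∧ NonTangential ρ d c} where
  top_mem := by
    obtain ⟨e, he, hPe⟩ := hbdd
    exact ⟨e, he, hPe, h.nt_top e⟩
  bot_notMem := by
    rintro ⟨d, -, hd, hd'⟩
    rw [le_bot_iff.1 (h.nt_le hd')] at hd
    exact hbot hd
  inf_mem := by
    rintro a b ⟨d, hdI, hd, hda⟩ ⟨e, heI, he, heb⟩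
    exact ⟨d ⊓ e, I.lower inf_le_left hdI, hinf hd he, h.nt_inf hda heb⟩
  mem_of_le := by
    rintro a b hab ⟨d, hdI, hd, hda⟩
    exact ⟨d, hdI, hd, h.nt_mono le_rfl hab hda⟩
  round := by
    rintro a ⟨d, hdI, hd, hda⟩
    obtain ⟨e, heI, hde, hea⟩ := h.interpolate d hdI a hda
    exact ⟨e, heI, ⟨d, hdI, hd, hde⟩, hea⟩
  maximal := by
    intro a b ha hab
    -- In `a ≪ c ≪ d ≪ b` the middle inclusion is decided by `P`, and the outer ones supply the
    -- non-tangential gap. Since `cᶜ` may be unbounded, it is cut down by a bounded member `e`.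
    obtain ⟨d, hdI, had, hdb⟩ := h.interpolate a ha b hab
    obtain ⟨c, hcI, hac, hcd⟩ := h.interpolate a ha d had
    rcases hmax hdI hcd with hc | hd
    · obtain ⟨e, heI, he⟩ := hbdd
      exact Or.inl ⟨e ⊓ cᶜ, I.lower inf_le_left heI, hinf he hc,
        h.nt_mono inf_le_right le_rfl (h.nt_compl hac)⟩
    · exact Or.inr ⟨d, hdI, hd, hdb⟩

/-- The elements not in contact with `a` form an ideal `J` with no member above `b`. The complement
of a prime ideal containing `J` and avoiding `b` is a filter containing `b`, all of whose members
touch `a`; it generates the end. -/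
theorem IsLocalContact.exists_isEnd_of_bounded {B : Type u} [BooleanAlgebra B] {ρ : B → B → Prop}
    {I : Order.Ideal B} (h : IsLocalContact ρ I) {a b : B} (hb : b ∈ I) (hab : ρ a b) :
    ∃ p, IsEnd ρ I p ∧ aᶜ ∉ p ∧ bᶜ ∉ p := by
  let J : Order.Ideal B :=
    { carrier := {c | ¬ ρ a c}
      lower' := fun c d hdc hc hd => hc (h.mono_right hdc hd)
      nonempty' := ⟨⊥, fun h' => (h.ne_bot _ _ h').2 rfl⟩
      directed' := fun c hc d hd => ⟨c ⊔ d, fun h' => ((h.sup_iff _ _ _).1 h').elim hc hd,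
        le_sup_left, le_sup_right⟩ }
  have hdisj : Disjoint ((Order.PFilter.principal b : Order.PFilter B) : Set B) (J : Set B) :=
    Set.disjoint_left.2 fun c hbc hc => hc (h.mono_right hbc hab)
  obtain ⟨M, hM, hJM, hbM⟩ := DistribLattice.prime_ideal_of_disjoint_filter_ideal hdisj
  have hbM' : b ∉ M := Set.disjoint_left.1 hbM (show b ≤ b from le_rfl)
  have hρ : ∀ {c}, c ∉ M → ρ a c := fun {c} hc => by
    by_contra h'
    exact hc (hJM h')
  have hinf : ∀ {c d}, c ∉ M → d ∉ M → c ⊓ d ∉ M := fun hc hd hcd =>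
    (hM.mem_or_mem hcd).elim hc hd
  refine ⟨_, h.isEnd_of (P := fun c => c ∉ M) (fun h' => h' M.bot_mem) hinf ⟨b, hb, hbM'⟩ ?_, ?_, ?_⟩
  · intro c d _ hcd
    by_contra! h'
    have hc : c ∉ M := fun hc => hM.toIsProper.ne_univ (by
      have := M.sup_mem hc h'.1
      rw [sup_compl_eq_top] at this
      exact Set.eq_univ_of_forall fun x => M.lower le_top this)
    exact hc (M.lower (h.nt_le hcd) h'.2)
  · rintro ⟨d, -, hd, hda⟩
    rw [NonTangential, compl_compl] at hda
    exact hda (h.symm _ _ (hρ hd))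
  · rintro ⟨d, -, hd, hdb⟩
    refine hinf hd hbM' ?_
    rw [(le_compl_iff_disjoint_right.1 (h.nt_le hdb)).eq_bot]
    exact M.bot_mem

theorem IsLocalContact.exists_isEnd {B : Type u} [BooleanAlgebra B] {ρ : B → B → Prop}
    {I : Order.Ideal B} (h : IsLocalContact ρ I) {a b : B} (hab : ρ a b) :
    ∃ p, IsEnd ρ I p ∧ aᶜ ∉ p ∧ bᶜ ∉ p := by
  obtain ⟨c, hc, hac⟩ := h.exists_bounded_contact a b hab
  obtain ⟨p, hp, ha, hb⟩ := h.exists_isEnd_of_bounded (I.lower inf_le_left hc) hac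
  exact ⟨p, hp, ha, fun h' => hb (hp.mem_of_le (compl_le_compl inf_le_right) h')⟩

/-- The space of ends of a complete local contact algebra. -/
def Ends (A : DSkeLC.{u}) : Type u := {p : Set A.carrier // IsEnd A.contact A.bounded p}

/-! ### Topology of the space of ends and its regular open sets -/

namespace Ends

variable {A : DSkeLC.{u}}

/-- The basic open set of ends containing `a`. -/
def basic (a : A.carrier) : Set (Ends A) := {p | a ∈ p.1}

theorem basic_mono {a b : A.carrier} (h : a ≤ b) : basic a ⊆ basic b :=
  fun p hp => p.2.mem_of_le h hp

theorem basic_inf (a b : A.carrier) : basic (a ⊓ b) = basic a ∩ basic b :=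
  subset_antisymm (subset_inter (basic_mono inf_le_left) (basic_mono inf_le_right))
    fun p hp => p.2.inf_mem hp.1 hp.2

theorem notMem_of_compl_mem (p : Ends A) {a : A.carrier} (h : aᶜ ∈ p.1) : a ∉ p.1 := fun h' => by
  have := p.2.inf_mem h' h
  rw [inf_compl_eq_bot] at this
  exact p.2.bot_notMem this

theorem basic_nonempty {a : A.carrier} (h : a ≠ ⊥) : (basic a).Nonempty := by
  obtain ⟨b, hb, hb0, hba⟩ := A.isLocalContact.exists_bounded_nonTangential a h
  obtain ⟨p, hp, hbp, -⟩ := A.isLocalContact.exists_isEnd (A.isLocalContact.refl b hb0)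
  exact ⟨⟨p, hp⟩, (hp.maximal hb hba).resolve_left hbp⟩

theorem basic_subset {a b : A.carrier} : basic a ⊆ basic b ↔ a ≤ b := by
  refine ⟨fun h => ?_, basic_mono⟩
  by_contra hab
  have h0 : a ⊓ bᶜ ≠ ⊥ := fun h0 => hab (disjoint_compl_right_iff.1 (disjoint_iff.2 h0))
  obtain ⟨p, hp⟩ := basic_nonempty h0
  rw [basic_inf] at hp
  exact notMem_of_compl_mem p hp.2 (h hp.1)

theorem exists_bounded_mem (p : Ends A) : ∃ e ∈ A.bounded, p ∈ basic e := by
  obtain ⟨e, he, hep, -⟩ := p.2.round p.2.top_mem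
  exact ⟨e, he, hep⟩

instance : TopologicalSpace (Ends A) := generateFrom (range basic)

theorem isTopologicalBasis_basic : IsTopologicalBasis (range (basic (A := A))) where
  exists_subset_inter := by
    rintro _ ⟨a, rfl⟩ _ ⟨b, rfl⟩ p hp
    exact ⟨basic (a ⊓ b), mem_range_self _, by rwa [basic_inf], (basic_inf a b).subset⟩
  sUnion_eq := eq_univ_of_forall fun p => ⟨basic ⊤, mem_range_self _, p.2.top_mem⟩
  eq_generateFrom := rfl

theorem isOpen_basic (a : A.carrier) : IsOpen (basic a) :=
  isTopologicalBasis_basic.isOpen (mem_range_self a)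

/-- Nonzero elements have ends, so a basic set disjoint from `basic a` comes from an element below
`aᶜ`. -/
theorem closure_basic (a : A.carrier) : closure (basic a) = (basic aᶜ)ᶜ := by
  ext p
  rw [isTopologicalBasis_basic.mem_closure_iff, forall_mem_range]
  constructor
  · intro h hp
    obtain ⟨q, hq, hq'⟩ := h _ hp
    exact notMem_of_compl_mem q hq hq'
  · intro h b hp
    rw [← basic_inf]
    refine basic_nonempty fun h0 => h ?_
    exact basic_mono (le_compl_iff_disjoint_right.2 (disjoint_iff.2 h0)) hp

theorem interior_closure_basic (a : A.carrier) : interior (closure (basic a)) = basic a := by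
  rw [closure_basic, interior_compl, closure_basic, compl_compl, compl_compl]

theorem closure_basic_inter_nonempty_iff {a b : A.carrier} :
    (closure (basic a) ∩ closure (basic b)).Nonempty ↔ A.contact a b := by
  simp only [closure_basic]
  constructor
  · rintro ⟨p, ha, hb⟩
    by_contra hab
    obtain ⟨e, he, hep⟩ := exists_bounded_mem p
    -- Maximality of an end only concerns bounded elements, so `a` is first met with a bounded `e`
    -- in `p`.
    have h : NonTangential A.contact (e ⊓ a) bᶜ := by
      rw [NonTangential, compl_compl]
      exact fun h => hab (A.isLocalContact.mono inf_le_right le_rfl h)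
    rcases p.2.maximal (A.bounded.lower inf_le_left he) h with h | h
    · refine ha (p.2.mem_of_le ?_ (p.2.inf_mem hep h))
      rw [compl_inf, inf_sup_left, inf_compl_eq_bot, bot_sup_eq]
      exact inf_le_right
    · exact hb h
  · intro h
    obtain ⟨p, hp, ha, hb⟩ := A.isLocalContact.exists_isEnd h
    exact ⟨⟨p, hp⟩, ha, hb⟩

theorem exists_disjoint_basic {p q : Ends A} (h : ¬ p.1 ⊆ q.1) :
    ∃ b, p ∈ basic b ∧ q ∈ basic bᶜ := by
  obtain ⟨a, hap, haq⟩ := not_subset.1 h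
  obtain ⟨b, hb, hbp, hba⟩ := p.2.round hap
  exact ⟨b, hbp, (q.2.maximal hb hba).resolve_right haq⟩

theorem disjoint_basic_compl (a : A.carrier) : Disjoint (basic a) (basic aᶜ) :=
  Set.disjoint_left.2 fun p h h' => notMem_of_compl_mem p h' h

instance : T2Space (Ends A) where
  t2 p q hpq := by
    by_cases h : p.1 ⊆ q.1
    · have h' : ¬ q.1 ⊆ p.1 := fun h' => hpq (Subtype.ext (h.antisymm h'))
      obtain ⟨b, hq, hp⟩ := exists_disjoint_basic h'
      exact ⟨_, _, isOpen_basic _, isOpen_basic _, hp, hq, (disjoint_basic_compl b).symm⟩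
    · obtain ⟨b, hp, hq⟩ := exists_disjoint_basic h
      exact ⟨_, _, isOpen_basic _, isOpen_basic _, hp, hq, disjoint_basic_compl b⟩

theorem closure_basic_subset {a b : A.carrier} (ha : a ∈ A.bounded)
    (hab : NonTangential A.contact a b) : closure (basic a) ⊆ basic b := by
  rw [closure_basic]
  exact fun p hp => (p.2.maximal ha hab).resolve_left hp

/-- For an ultrafilter containing the closure, the elements `c` with `basic c` in it form a filter
that decides non-tangential inclusions; the end it generates is a limit. -/
theorem isCompact_closure_basic {a : A.carrier} (ha : a ∈ A.bounded) :
    IsCompact (closure (basic a)) := by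
  rw [isCompact_iff_ultrafilter_le_nhds']
  intro 𝒰 h𝒰
  obtain ⟨e, he, hae, -⟩ := A.isLocalContact.interpolate a ha ⊤ (A.isLocalContact.nt_top a)
  have hend := A.isLocalContact.isEnd_of (P := fun c => basic c ∈ 𝒰)
    (fun h => by
      obtain ⟨p, hp⟩ := 𝒰.nonempty_of_mem h
      exact p.2.bot_notMem hp)
    (fun {c d} hc hd => by
      rw [basic_inf]
      exact inter_mem hc hd)
    ⟨e, he, mem_of_superset h𝒰 (closure_basic_subset ha hae)⟩
    (fun {c d} hd hcd => by
      by_contra! h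
      rw [← Ultrafilter.compl_mem_iff_notMem, ← closure_basic] at h
      exact h.2 (mem_of_superset h.1 (closure_basic_subset
        (A.bounded.lower (A.isLocalContact.nt_le hcd) hd) hcd)))
  obtain ⟨p, hp⟩ : ∃ p : Ends A, ∀ b, b ∈ p.1 ↔
      ∃ d ∈ A.bounded, basic d ∈ 𝒰 ∧ NonTangential A.contact d b :=
    ⟨⟨_, hend⟩, fun _ => Iff.rfl⟩
  refine ⟨p, ?_, ?_⟩
  · rw [closure_basic]
    intro hpa
    obtain ⟨c, -, hc, hca⟩ := (hp _).1 hpa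
    have h := inter_mem h𝒰 (mem_of_superset hc (basic_mono (A.isLocalContact.nt_le hca)))
    rw [closure_basic, compl_inter_self] at h
    exact Ultrafilter.empty_notMem h
  · rw [isTopologicalBasis_basic.nhds_hasBasis.ge_iff]
    rintro _ ⟨⟨b, rfl⟩, hpb⟩
    obtain ⟨c, -, hc, hcb⟩ := (hp _).1 hpb
    exact mem_of_superset hc (basic_mono (A.isLocalContact.nt_le hcb))

instance : WeaklyLocallyCompactSpace (Ends A) where
  exists_compact_mem_nhds p := by
    obtain ⟨e, he, hp⟩ := exists_bounded_mem p
    exact ⟨_, isCompact_closure_basic he,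
      mem_of_superset ((isOpen_basic e).mem_nhds hp) subset_closure⟩

/-- Bounded elements give a directed open cover of the space, so a compact closure lies in a single
`basic e`, whence `a ≤ e`. -/
theorem isCompact_closure_basic_iff {a : A.carrier} :
    IsCompact (closure (basic a)) ↔ a ∈ A.bounded := by
  refine ⟨fun h => ?_, isCompact_closure_basic⟩
  have : Nonempty A.bounded := ⟨⟨⊥, A.bounded.bot_mem⟩⟩
  obtain ⟨e, he⟩ := h.elim_directed_cover (fun e : A.bounded => basic (e : A.carrier))
    (fun e => isOpen_basic _) (fun p _ => mem_iUnion.2 (by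
      obtain ⟨e, he, hp⟩ := exists_bounded_mem p
      exact ⟨⟨e, he⟩, hp⟩))
    (fun e f => ⟨⟨e ⊔ f, A.bounded.sup_mem e.2 f.2⟩, basic_mono le_sup_left,
      basic_mono le_sup_right⟩)
  exact A.bounded.lower (basic_subset.1 (subset_closure.trans he)) e.2

theorem exists_basic_eq (U : RegularOpens (Ends A)) : ∃ a, basic a = (U : Set (Ends A)) := by
  refine ⟨sSup {a | basic a ⊆ U}, subset_antisymm ?_ fun p hp => ?_⟩
  -- An end containing the join lies in the closure of `U`: if `basic c` missed `U`, then `c` would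
  -- be disjoint from every joinand, hence by distributivity from the join.
  · refine (interior_maximal (fun p hp => ?_) (isOpen_basic _)).trans U.interior_closure.subset
    rw [isTopologicalBasis_basic.mem_closure_iff, forall_mem_range]
    intro c hc
    have h := p.2.inf_mem hc hp
    rw [inf_sSup_eq] at h
    by_contra hne
    refine p.2.bot_notMem ?_
    convert h
    symm
    rw [iSup₂_eq_bot]
    intro a ha
    by_contra h0
    obtain ⟨q, hq⟩ := basic_nonempty h0
    rw [basic_inf] at hq
    exact hne ⟨q, hq.1, ha hq.2⟩
  · obtain ⟨_, ⟨a, rfl⟩, hpa, haU⟩ := isTopologicalBasis_basic.exists_subset_of_mem_open hp U.isOpen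
    exact basic_mono (le_sSup haU) hpa

/-- A complete local contact algebra is isomorphic to the algebra of regular open sets of its
space of ends. -/
noncomputable def basicIso (A : DSkeLC.{u}) : A.carrier ≃o RegularOpens (Ends A) :=
  RelIso.ofSurjective
    (OrderEmbedding.ofMapLEIff
      (fun a => RegularOpens.mk' (basic a) (interior_closure_basic a)) fun _ _ => basic_subset)
    fun U => by
      obtain ⟨a, ha⟩ := exists_basic_eq U
      exact ⟨a, SetLike.coe_injective ha⟩

end Ends

/-! ### Isomorphisms of complete local contact algebras -/

namespace DSkeLC

variable {A B : DSkeLC.{u}}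

theorem leftAdj_orderIso (e : A.carrier ≃o B.carrier) (b : B.carrier) :
    leftAdj (CompleteLatticeHom.OrderIso.toCompleteLatticeHom e) b = e.symm b :=
  (leftAdj_gc (CompleteLatticeHom.OrderIso.toCompleteLatticeHom e)).l_unique e.symm.to_galoisConnection
    fun _ => rfl

/-- An order isomorphism that preserves contact and boundedness both ways is a morphism. -/
def homOfOrderIso (e : A.carrier ≃o B.carrier) (hc : ∀ a b, B.contact (e a) (e b) ↔ A.contact a b)
    (hb : ∀ a, e a ∈ B.bounded ↔ a ∈ A.bounded) : A ⟶ B where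
  toHom := CompleteLatticeHom.OrderIso.toCompleteLatticeHom e
  reflects_contact a b := (hc a b).1
  leftAdj_bounded b h := by
    rw [leftAdj_orderIso, ← hb, e.apply_symm_apply]
    exact h

theorem homOfOrderIso_LO (e : A.carrier ≃o B.carrier)
    (hc : ∀ a b, B.contact (e a) (e b) ↔ A.contact a b)
    (hb : ∀ a, e a ∈ B.bounded ↔ a ∈ A.bounded) : LO (homOfOrderIso e hc hb) := by
  intro a b _ h
  have h' : A.contact (leftAdj (CompleteLatticeHom.OrderIso.toCompleteLatticeHom e) b) a := h
  rw [leftAdj_orderIso, ← hc, e.apply_symm_apply] at h'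
  exact h'

/-- An order isomorphism that preserves contact and boundedness both ways is an isomorphism. -/
def isoOfOrderIso (e : A.carrier ≃o B.carrier) (hc : ∀ a b, B.contact (e a) (e b) ↔ A.contact a b)
    (hb : ∀ a, e a ∈ B.bounded ↔ a ∈ A.bounded) : (⟨A⟩ : DOpLC) ≅ ⟨B⟩ where
  hom := ⟨homOfOrderIso e hc hb, homOfOrderIso_LO e hc hb⟩
  inv := ⟨homOfOrderIso e.symm (fun a b => by simp [← hc]) (fun a => by simp [← hb]),
    homOfOrderIso_LO _ _ _⟩
  hom_inv_id := WideSubcategory.hom_ext _ <| Hom.ext <| CompleteLatticeHom.ext e.symm_apply_apply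
  inv_hom_id := WideSubcategory.hom_ext _ <| Hom.ext <| CompleteLatticeHom.ext e.apply_symm_apply

end DSkeLC

instance : regularOpensFunctor.{u}.EssSurj where
  mem_essImage A := ⟨.op ⟨Ends A.obj⟩, ⟨(DSkeLC.isoOfOrderIso (A := A.obj)
    (B := regularOpensObj ⟨Ends A.obj⟩) (Ends.basicIso A.obj)
    (fun _ _ => Ends.closure_basic_inter_nonempty_iff)
    (fun _ => Ends.isCompact_closure_basic_iff)).symm⟩⟩

/-! ### A morphism of `DSkeLC` that does not satisfy (LO) -/

/-- Overlap is a local contact relation for which every element is bounded. -/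
theorem isLocalContact_overlap {B : Type u} [BooleanAlgebra B] :
    IsLocalContact (fun a b : B => a ⊓ b ≠ ⊥) ⊤ where
  refl a h := by rwa [inf_idem]
  ne_bot a b h := ⟨fun ha => h (by rw [ha, bot_inf_eq]), fun hb => h (by rw [hb, inf_bot_eq])⟩
  symm a b h := by rwa [inf_comm]
  sup_iff a b c := by rw [inf_sup_left, Ne, sup_eq_bot_iff, not_and_or]
  interpolate a ha c h := ⟨a, ha, by simp [NonTangential], h⟩
  exists_bounded_contact a b h := ⟨⊤, trivial, by rwa [top_inf_eq]⟩
  exists_bounded_nonTangential a h := ⟨a, trivial, h, by simp [NonTangential]⟩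

/-- The algebra of `A` with overlap as contact relation and all elements bounded. -/
def DSkeLC.overlap (A : DSkeLC.{u}) : DSkeLC.{u} where
  carrier := A.carrier
  contact a b := a ⊓ b ≠ ⊥
  bounded := ⊤
  isLocalContact := isLocalContact_overlap

/-- The identity as a morphism to the same algebra with the smallest contact relation. -/
def DSkeLC.toOverlap (A : DSkeLC.{u}) (hA : A.bounded = ⊤) : A ⟶ A.overlap where
  toHom := CompleteLatticeHom.id A.carrier
  reflects_contact _ _ h := A.isLocalContact.of_inf_ne_bot h
  leftAdj_bounded _ _ := by
    rw [hA]
    trivial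

/-- The left adjoint of the identity is the identity, so (LO) would make `a` overlap its own
complement. -/
theorem DSkeLC.not_LO_toOverlap {A : DSkeLC.{u}} (hA : A.bounded = ⊤) {a : A.carrier}
    (ha : A.contact a aᶜ) : ¬ LO (A.toOverlap hA) := by
  intro h
  have h' : A.contact (leftAdj (CompleteLatticeHom.id A.carrier) a) aᶜ → a ⊓ aᶜ ≠ ⊥ :=
    h aᶜ a trivial
  rw [leftAdj_id, inf_compl_eq_bot] at h'
  exact h' ha rfl

theorem RegularOpens.bounded_eq_top {X : Type u} [TopologicalSpace X] [CompactSpace X] :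
    bounded X = ⊤ :=
  top_unique fun _ _ => isClosed_closure.isCompact

/-- Without contact `U` would be clopen, contradicting connectedness. -/
theorem RegularOpens.contact_compl {X : Type u} [TopologicalSpace X] [PreconnectedSpace X]
    {U : RegularOpens X} (h : U ≠ ⊥) (h' : U ≠ ⊤) : contact U Uᶜ := by
  by_contra hc
  rw [contact, closure_coe_compl, inter_compl_nonempty_iff, not_not] at hc
  rcases isClopen_iff.1 ⟨isClosed_of_closure_subset hc, U.isOpen⟩ with h0 | h1
  · exact h (SetLike.coe_injective h0)
  · exact h' (SetLike.coe_injective h1)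

theorem exists_contact_compl : ∃ A : DSkeLC.{u}, A.bounded = ⊤ ∧ ∃ a, A.contact a aᶜ := by
  have : ConnectedSpace (ULift.{u} unitInterval) :=
    ULift.up_surjective.connectedSpace continuous_uliftUp
  let X : OpLC.{u} := ⟨ULift.{u} unitInterval⟩
  -- `W` contains `0` and its closure misses `1`, so it is neither `⊥` nor `⊤`.
  obtain ⟨W, -, h0, h1⟩ := RegularOpens.exists_mem (X := ULift.{u} unitInterval)
    (isOpen_compl_singleton (x := ⟨1⟩)) (show (⟨0⟩ : ULift.{u} unitInterval) ∈ _ by simp)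
  refine ⟨regularOpensObj X, RegularOpens.bounded_eq_top (X := ULift.{u} unitInterval), W,
    RegularOpens.contact_compl (X := ULift.{u} unitInterval) ?_ ?_⟩
  · exact RegularOpens.ne_bot_iff.2 ⟨_, h0⟩
  · rintro rfl
    exact h1 (subset_closure (mem_univ (⟨1⟩ : ULift.{u} unitInterval))) rfl

theorem not_full_wideSubcategoryInclusion : ¬ (wideSubcategoryInclusion LO.{u}).Full := by
  intro h
  obtain ⟨A, hA, a, ha⟩ := exists_contact_compl.{u}
  obtain ⟨φ, hφ⟩ := (wideSubcategoryInclusion LO.{u}).map_surjective (X := (⟨A⟩ : DOpLC))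
    (Y := (⟨A.overlap⟩ : DOpLC)) (A.toOverlap hA)
  refine DSkeLC.not_LO_toOverlap hA ha ?_
  rw [← hφ]
  exact φ.property

end OpenDuality

theorem theorem2p17 :
    Nonempty (OpenDuality.OpLC.{u}ᵒᵖ ≌ OpenDuality.DOpLC.{u}) ∧
      ¬ (wideSubcategoryInclusion OpenDuality.LO.{u}).Full := by
  have : OpenDuality.regularOpensFunctor.{u}.IsEquivalence := {}
  exact ⟨⟨OpenDuality.regularOpensFunctor.asEquivalence⟩,
    OpenDuality.not_full_wideSubcategoryInclusion⟩
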